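/- Let $\mathbb T=\mathbb R/2\pi\mathbb Z$, $\Omega=(-1,1)_x\times\mathbb T_y$ and $\Delta_G=\partial_x^2+x^2\partial_y^2$ with Dirichlet boundary condition at $x=\pm1$. For $u_0\in L^2(\Omega)$ let $e^{it\Delta_G}u_0\in C(\mathbb R;L^2(\Omega))$ denote the solution $u$ of $$i\partial_tu+\Delta_Gu=0,\qquad u|_{t=0}=u_0,\qquad u|_{x=\pm1}=0 .$$ Let $\omega=(-1,1)\times I$, where $I\subset\mathbb T$ is a finite union of intervals, and let $\mathcal L(\omega)$ be the supremum of the lengths of the closed arcs of the circle $\{x=0\}$ that do not meet $\omega$ (with $\mathcal L(\omega)=0$ if there are none). Let $0<T_0\le\mathcal L(\omega)$. Then there is a sequence $(u_{k,0})_{k\in\mathbb N}\subset L^2(\Omega)$ with $\|u_{k,0}\|_{L^2(\Omega)}=1$ for all $k$ and $$\lim_{k\to\infty}\int_0^{T_0}\|e^{it\Delta_G}u_{k,0}\|_{L^2(\omega)}^2\,dt=0 .$$ In particular the observability inequality $\|u_0\|_{L^2(\Omega)}^2\le C\int_0^{T_0}\|e^{it\Delta_G}u_0\|_{L^2(\omega)}^2\,dt$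 for all $u_0\in L^2(\Omega)$ fails for every constant $C$. -/

import Mathlib

open Real MeasureTheory Set Filter Topology

noncomputable section

/-- The torus `ℝ / 2πℤ`. -/
abbrev Torus : Type := AddCircle (2 * π)

instance factTwoPiPos : Fact (0 < 2 * π) := ⟨Real.two_pi_pos⟩

/-- The open cylinder `Ω = (-1,1) × 𝕋`, as a subset of `ℝ × 𝕋`. -/
def grushinCylinder : Set (ℝ × Torus) := Ioo (-1 : ℝ) 1 ×ˢ univ

/-- The measure `dx dy` on `Ω` (the torus has total mass `2π`). -/
def cylinderMeasure : Measure (ℝ × Torus) := volume.restrict grushinCylinder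

/-- The Hilbert space `L²(Ω)` of complex-valued functions. -/
abbrev L2Cylinder : Type := Lp ℂ 2 cylinderMeasure

/-- The Grushin operator `Δ_G = ∂ₓ² + x² ∂_y²` acting on functions on `ℝ × 𝕋`. -/
def grushinLaplacian (φ : ℝ × Torus → ℂ) (p : ℝ × Torus) : ℂ :=
  iteratedDeriv 2 (fun s : ℝ => φ (s, p.2)) p.1 +
    (p.1 : ℂ) ^ 2 * iteratedDeriv 2 (fun s : ℝ => φ (p.1, p.2 + (s : Torus))) 0

/-- Functions on the closed cylinder `[-1,1] × 𝕋` that are smooth up to the boundary (given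
through a smooth extension to `ℝ × 𝕋`) and vanish at `x = ±1`. Nothing is required of their
normal derivative at the boundary. They form a core of the Dirichlet operator `Δ_G`. -/
structure IsDirichletTestFunction (φ : ℝ × Torus → ℂ) : Prop where
  smooth : ContDiff ℝ ((⊤ : ℕ∞) : WithTop ℕ∞) (fun p : ℝ × ℝ => φ (p.1, (p.2 : Torus)))
  left : ∀ y : Torus, φ (-1, y) = 0
  right : ∀ y : Torus, φ (1, y) = 0

/-- `u(t) = e^{itΔ_G} u₀`: `u ∈ C(ℝ; L²(Ω))` is the solution of
`i ∂ₜ u + Δ_G u = 0`, `u|_{t=0} = u₀`, `u|_{x=±1} = 0`, in the weak sense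
`d/dt ∫_Ω u(t) φ dx dy = i ∫_Ω u(t) Δ_G φ dx dy`, for all `t` and all smooth `φ` vanishing at
`x = ±1`. Since the normal derivative of `φ` is free, the identity contains the Dirichlet
condition on `u`. With the Dirichlet eigenfunctions `φ = φ_{m,n}(x) e^{iny}` as test functions it
says that every coefficient of `u(t)` in the eigenbasis is `e^{-itλ_{m,n}²}` times that of
`u₀`, so that `u` is determined by `u₀`. -/
structure IsGrushinEvolution (u₀ : L2Cylinder) (u : ℝ → L2Cylinder) : Prop where
  continuous : Continuous u
  initial : u 0 = u₀
  weak : ∀ φ : ℝ × Torus → ℂ, IsDirichletTestFunction φ → ∀ t : ℝ,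
    HasDerivAt (fun s : ℝ => ∫ p, u s p * φ p ∂cylinderMeasure)
      (Complex.I * ∫ p, u t p * grushinLaplacian φ p ∂cylinderMeasure) t

/-- The squared norm `‖f‖²_{L²(ω)}` of the restriction of `f ∈ L²(Ω)` to `ω ⊆ Ω`. -/
def normSqOn (ω : Set (ℝ × Torus)) (f : L2Cylinder) : ℝ :=
  ∫ p in ω, ‖f p‖ ^ 2 ∂cylinderMeasure

/-- `ω = (-1,1) × I` where `I ⊆ 𝕋` is a finite union of intervals (images in `𝕋` of intervals of
`ℝ`, whether open, closed or half-open). -/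
def IsHorizontalStrips (ω : Set (ℝ × Torus)) : Prop :=
  ∃ (N : ℕ) (J : Fin N → Set ℝ), (∀ k, (J k).OrdConnected) ∧
    ω = Ioo (-1 : ℝ) 1 ×ˢ ⋃ k, (fun y : ℝ => (y : Torus)) '' J k

/-- `𝓛(ω)`: the supremum of the lengths `s` of the closed arcs `{0} × [y, y + s]` of the circle
`{x = 0}` which do not meet `ω`. -/
def gapLength (ω : Set (ℝ × Torus)) : ℝ :=
  sSup {s : ℝ | 0 ≤ s ∧ s ≤ 2 * π ∧
    ∃ y : ℝ, ∀ r ∈ Icc y (y + s), ((0 : ℝ), (r : Torus)) ∉ ω}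

end

/-! At frequency `n` in `y`, `-Δ_G` becomes the harmonic oscillator `-∂ₓ² + n²x²` on `(-1,1)`. Its
Dirichlet ground state is nearly the Gaussian `e^{-nx²/2}`, with eigenvalue `n + μ` and `μ =
O(1/n)`. The mode `f_n(x) e^{iny}` therefore evolves almost like `e^{in(y-t)}`: a packet of such
modes is transported along `{x = 0}` at unit speed, without dispersing on a fixed time interval.

Fix a trigonometric polynomial `P` with frequencies in `{0, …, m}` and superpose the modes `N + j`,
weighted by its coefficients. For large `N` the solution is uniformly within `K/N` of `e^{iN(y-t)}
e^{-Nx²/2} P(y-t)`. The squared error is `O(N⁻²)`, whereas the Gaussian has squared mass at least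
`1/(3N)`, so the error is relatively negligible. What remains is a transport problem: if `|P|²`
peaks at the start of an arc of length `s` avoiding `I`, the packet spends time at most about `T₀ -
s` in `ω`. The supremum defining `gapLength` allows `T₀ - s` to be arbitrarily small, even when `T₀`
equals it.

The spectral input is `exists_dirichlet_ground_state`, the approximation is
`exists_norm_modePacket_sub_le`, the transport estimate is `exists_trigPeak_transport_le`, and
`exists_isGrushinEvolution_integral_normSqOn_le` combines them. -/

/-! ### Entire power series and their derivatives. -/

theorem summable_mul_pow_of_le_div_factorial {a : ℕ → ℝ} {C K : ℝ}
    (ha : ∀ j, |a j| ≤ C * (K ^ j / j.factorial)) (x : ℝ) : Summable fun j => a j * x ^ j := by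
  refine Summable.of_norm_bounded (g := fun j => C * ((K * |x|) ^ j / j.factorial))
    ((Real.summable_pow_div_factorial (K * |x|)).mul_left C) fun j => ?_
  rw [norm_mul, norm_pow, Real.norm_eq_abs, Real.norm_eq_abs, mul_pow]
  calc |a j| * |x| ^ j ≤ C * (K ^ j / j.factorial) * |x| ^ j := by gcongr; exact ha j
    _ = _ := by ring

/-- Differentiating a series preserves the factorial bound, with `C` replaced by `C * K`, so
term-by-term differentiation can be iterated. -/
theorem abs_succ_mul_le_div_factorial {a : ℕ → ℝ} {C K : ℝ}
    (ha : ∀ j, |a j| ≤ C * (K ^ j / j.factorial)) (j : ℕ) :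
    |((j : ℝ) + 1) * a (j + 1)| ≤ C * K * (K ^ j / j.factorial) := by
  have h := ha (j + 1)
  rw [abs_mul, abs_of_nonneg (by positivity : (0 : ℝ) ≤ (j : ℝ) + 1)]
  calc ((j : ℝ) + 1) * |a (j + 1)| ≤ (j + 1) * (C * (K ^ (j + 1) / (j + 1).factorial)) := by gcongr
    _ = _ := by
      rw [Nat.factorial_succ]; push_cast; field_simp; ring

theorem hasDerivAt_tsum_mul_pow {a : ℕ → ℝ} {C K : ℝ}
    (ha : ∀ j, |a j| ≤ C * (K ^ j / j.factorial)) (x : ℝ) :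
    HasDerivAt (fun z => ∑' j, a j * z ^ j) (∑' j : ℕ, ((j : ℝ) + 1) * a (j + 1) * x ^ j) x := by
  set R := |x| + 1
  have hs : Summable fun j : ℕ => ((j : ℝ) * |a j| * R ^ (j - 1)) := by
    rw [← summable_nat_add_iff 1]
    refine ((summable_mul_pow_of_le_div_factorial (a := fun j => |((j : ℝ) + 1) * a (j + 1)|)
      (C := C * K) (K := K) (fun j => ?_) R)).congr fun j => ?_
    · rw [abs_abs]; exact abs_succ_mul_le_div_factorial ha j
    · rw [abs_mul, abs_of_nonneg (by positivity : (0 : ℝ) ≤ (j : ℝ) + 1)]; push_cast; simp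
  have h := hasDerivAt_tsum_of_isPreconnected (g := fun j z => a j * z ^ j)
    (g' := fun j z => a j * (j * z ^ (j - 1))) (t := Metric.ball 0 R) (y₀ := 0) (y := x) hs
    Metric.isOpen_ball (convex_ball _ _).isPreconnected
    (fun j y _ => (hasDerivAt_pow j y).const_mul (a j)) (fun j y hy => ?_)
    (by simp [R]; positivity) (summable_mul_pow_of_le_div_factorial ha 0) (by simp [R])
  · refine h.congr_deriv ?_
    rw [Summable.tsum_eq_zero_add (f := fun j : ℕ => a j * (j * x ^ (j - 1)))]
    · simp only [Nat.cast_zero, zero_mul, mul_zero, zero_add]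
      exact tsum_congr fun j => by rw [Nat.add_sub_cancel]; push_cast; ring
    · rw [← summable_nat_add_iff 1]
      refine (summable_mul_pow_of_le_div_factorial (abs_succ_mul_le_div_factorial ha) x).congr
        fun j => by rw [Nat.add_sub_cancel]; push_cast; ring
  · rw [norm_mul, norm_mul, norm_pow, Real.norm_eq_abs, Real.norm_natCast]
    have : ‖y‖ ≤ R := by simpa using (mem_ball_zero_iff.1 hy).le
    calc |a j| * (j * ‖y‖ ^ (j - 1)) ≤ |a j| * (j * R ^ (j - 1)) := by gcongr
      _ = _ := by ring

/-! ### The Kummer function and the Dirichlet ground state. -/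

/-- The Taylor coefficients of the Kummer function `z ↦ M(-δ, 1/2, n z)`. -/
noncomputable def kummerCoeff (n : ℕ) (δ : ℝ) (j : ℕ) : ℝ :=
  ∏ i ∈ Finset.range j, (2 * n * (i - δ) / ((i + 1) * (2 * i + 1)))

theorem kummerCoeff_succ (n : ℕ) (δ : ℝ) (j : ℕ) :
    kummerCoeff n δ (j + 1) = kummerCoeff n δ j * (2 * n * (j - δ) / ((j + 1) * (2 * j + 1))) :=
  Finset.prod_range_succ _ _

/-- Since `|j - δ| ≤ 2j + 1`, each factor is at most `2n/(j + 1)`. The bound is uniform in `δ`,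
which also gives continuity of the sum in `δ`. -/
theorem abs_kummerCoeff_le (n : ℕ) {δ : ℝ} (hδ : δ ∈ Icc (0 : ℝ) 1) (j : ℕ) :
    |kummerCoeff n δ j| ≤ 1 * ((2 * n : ℝ) ^ j / j.factorial) := by
  induction j with
  | zero => simp [kummerCoeff]
  | succ j ih =>
    have h1 : |(j : ℝ) - δ| ≤ 2 * j + 1 := by
      rw [abs_le]; constructor <;> linarith [hδ.1, hδ.2, (Nat.cast_nonneg j : (0 : ℝ) ≤ j)]
    rw [kummerCoeff_succ, abs_mul, abs_div, abs_mul, abs_of_nonneg (by positivity : (0 : ℝ) ≤ 2 * n),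
      abs_of_nonneg (by positivity : (0 : ℝ) ≤ (j + 1) * (2 * j + 1))]
    calc |kummerCoeff n δ j| * (2 * n * |j - δ| / ((j + 1) * (2 * j + 1)))
        ≤ (1 * ((2 * n : ℝ) ^ j / j.factorial)) *
          (2 * n * (2 * j + 1) / ((j + 1) * (2 * j + 1))) := by gcongr
      _ = _ := by rw [Nat.factorial_succ]; push_cast; field_simp; ring

/-- The factor `i = 0` carries `-δ ≤ 0`, and every later one carries `i - δ ≥ 0`. -/
theorem kummerCoeff_succ_nonpos (n : ℕ) {δ : ℝ} (hδ : δ ∈ Icc (0 : ℝ) 1) (j : ℕ) :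
    kummerCoeff n δ (j + 1) ≤ 0 := by
  induction j with
  | zero =>
    simp [kummerCoeff]
    nlinarith [hδ.1, (Nat.cast_nonneg n : (0 : ℝ) ≤ n), mul_nonneg (Nat.cast_nonneg n : (0 : ℝ) ≤ n) hδ.1]
  | succ j ih =>
    rw [kummerCoeff_succ]
    refine mul_nonpos_of_nonpos_of_nonneg ih ?_
    have : (0 : ℝ) ≤ ((j + 1 : ℕ) : ℝ) - δ := by
      push_cast; linarith [hδ.2, (Nat.cast_nonneg j : (0 : ℝ) ≤ j)]
    positivity

theorem kummerCoeff_zero (n : ℕ) (δ : ℝ) : kummerCoeff n δ 0 = 1 := by simp [kummerCoeff]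

theorem kummerCoeff_one (n : ℕ) (δ : ℝ) : kummerCoeff n δ 1 = -(2 * n * δ) := by
  simp [kummerCoeff]

theorem summable_kummerCoeff (n : ℕ) {δ : ℝ} (hδ : δ ∈ Icc (0 : ℝ) 1) :
    Summable (kummerCoeff n δ) := by
  simpa using summable_mul_pow_of_le_div_factorial (abs_kummerCoeff_le n hδ) 1

/-- Intermediate value theorem in `δ`: the series terminates at both ends, with sum `1` at `δ = 0`
and `1 - 2n < 0` at `δ = 1`. The zero imposes the Dirichlet condition at `x = ±1`. -/
theorem exists_tsum_kummerCoeff_eq_zero {n : ℕ} (hn : 1 ≤ n) :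
    ∃ δ ∈ Icc (0 : ℝ) 1, ∑' j, kummerCoeff n δ j = 0 := by
  have hc : ContinuousOn (fun δ => ∑' j, kummerCoeff n δ j) (Icc 0 1) := by
    have hs : Summable fun j : ℕ => 1 * ((2 * n : ℝ) ^ j / j.factorial) :=
      (Real.summable_pow_div_factorial _).mul_left 1
    have hcj : ∀ j, ContinuousOn (fun δ => kummerCoeff n δ j) (Icc 0 1) := fun j => by
      unfold kummerCoeff
      fun_prop
    exact continuousOn_tsum hcj hs fun j δ hδ => abs_kummerCoeff_le n hδ j
  have h0 : ∑' j, kummerCoeff n 0 j = 1 := by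
    rw [tsum_eq_single 0, kummerCoeff_zero]
    intro j hj
    exact Finset.prod_eq_zero (i := 0) (Finset.mem_range.2 (Nat.pos_of_ne_zero hj)) (by simp)
  have h1 : ∑' j, kummerCoeff n 1 j = 1 - 2 * n := by
    rw [(summable_kummerCoeff n (by simp)).tsum_eq_zero_add, tsum_eq_single 0]
    · simp [kummerCoeff_zero, kummerCoeff_one]; ring
    intro j hj
    exact Finset.prod_eq_zero (i := 1) (Finset.mem_range.2 (by omega)) (by simp)
  have hn' : (1 : ℝ) ≤ n := by exact_mod_cast hn
  obtain ⟨δ, hδ, h⟩ := intermediate_value_Icc' zero_le_one hc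
    (show (0 : ℝ) ∈ Icc (∑' j, kummerCoeff n 1 j) (∑' j, kummerCoeff n 0 j) by
      rw [h0, h1]; constructor <;> linarith)
  exact ⟨δ, hδ, h⟩

/-- The ground state of `-∂ₓ² + n² x²` on `(-1, 1)` with Dirichlet conditions: it is close to the
Gaussian, and its eigenvalue is close to `n`. -/
theorem exists_dirichlet_ground_state {n : ℕ} (hn : 1 ≤ n) :
    ∃ (f f' : ℝ → ℝ) (μ : ℝ), (∀ x, HasDerivAt f (f' x) x) ∧
      (∀ x, HasDerivAt f' (((n : ℝ) ^ 2 * x ^ 2 - (n + μ)) * f x) x) ∧ f 1 = 0 ∧ f (-1) = 0 ∧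
      0 ≤ μ ∧ μ ≤ 12 / n ∧
      ∀ x ∈ Icc (-1 : ℝ) 1, |f x - exp (-(n * x ^ 2 / 2))| ≤ x ^ 2 * exp (-(n * x ^ 2 / 2)) := by
  obtain ⟨δ, hδ, hsum⟩ := exists_tsum_kummerCoeff_eq_zero hn
  have hn' : (1 : ℝ) ≤ n := by exact_mod_cast hn
  set c := kummerCoeff n δ with hc
  have b0 := abs_kummerCoeff_le n hδ
  have b1 := abs_succ_mul_le_div_factorial b0
  have b2 := abs_succ_mul_le_div_factorial b1
  set h : ℝ → ℝ := fun z => ∑' j, c j * z ^ j with hh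
  set h1 : ℝ → ℝ := fun z => ∑' j : ℕ, ((j : ℝ) + 1) * c (j + 1) * z ^ j
  set h2 : ℝ → ℝ := fun z =>
    ∑' j : ℕ, ((j : ℝ) + 1) * (((j + 1 : ℕ) + 1) * c (j + 1 + 1)) * z ^ j
  have d0 : ∀ z, HasDerivAt h (h1 z) z := fun z => hasDerivAt_tsum_mul_pow b0 z
  have d1 : ∀ z, HasDerivAt h1 (h2 z) z := fun z => hasDerivAt_tsum_mul_pow b1 z
  -- Kummer's equation, rescaled to the variable `n z`; it is the coefficient recurrence read
  -- termwise.
  have ode : ∀ z, 2 * h1 z + 4 * (z * h2 z) - 4 * n * (z * h1 z) + 4 * n * δ * h z = 0 := by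
    intro z
    have hcongr : ∀ {g k : ℕ → ℝ} {s : ℝ}, (∀ j, g j = k j) → HasSum g s → HasSum k s :=
      fun hgk hg => funext hgk ▸ hg
    have s0 := summable_mul_pow_of_le_div_factorial b0 z
    have s1 := summable_mul_pow_of_le_div_factorial b1 z
    have s2 := summable_mul_pow_of_le_div_factorial b2 z
    have e2 : HasSum (fun j : ℕ => (j : ℝ) * ((j + 1) * c (j + 1)) * z ^ j) (z * h2 z) := by
      rw [← hasSum_nat_add_iff' 1]
      simp only [Finset.range_one, Finset.sum_singleton, Nat.cast_zero, zero_mul, sub_zero]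
      exact hcongr (fun j => by push_cast; ring) (s2.hasSum.mul_left z)
    have e1 : HasSum (fun j : ℕ => (j : ℝ) * c j * z ^ j) (z * h1 z) := by
      rw [← hasSum_nat_add_iff' 1]
      simp only [Finset.range_one, Finset.sum_singleton, Nat.cast_zero, zero_mul, sub_zero]
      exact hcongr (fun j => by push_cast; ring) (s1.hasSum.mul_left z)
    have := (((s1.hasSum.mul_left 2).add (e2.mul_left 4)).sub (e1.mul_left (4 * (n : ℝ)))).add
      (s0.hasSum.mul_left (4 * n * δ))
    refine this.unique ?_
    refine hcongr (fun j => ?_) hasSum_zero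
    symm
    rw [show kummerCoeff n δ (j + 1) = c (j + 1) from rfl, show c (j + 1) = _ from kummerCoeff_succ n δ j]
    rw [show kummerCoeff n δ j = c j from rfl]
    field_simp
    ring
  have hsc : Summable c := summable_kummerCoeff n hδ
  have hsc1 : Summable fun j => -c (j + 1) := ((summable_nat_add_iff 1).2 hsc).neg
  have hnn : ∀ j, 0 ≤ -c (j + 1) := fun j => neg_nonneg.2 (kummerCoeff_succ_nonpos n hδ j)
  -- As `h 1 = 0` and `c 0 = 1`, the nonnegative numbers `-c (j + 1)` sum to `1`. All the
  -- quantitative bounds come from this.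
  have htail : ∑' j, -c (j + 1) = 1 := by
    have := hsc.tsum_eq_zero_add
    rw [hsum, show c 0 = 1 from kummerCoeff_zero n δ] at this
    rw [tsum_neg]; linarith
  have hle : ∀ j, -c (j + 1) ≤ 1 := fun j => htail ▸ hsc1.le_tsum j fun i _ => hnn i
  have l1 : 2 * n * δ ≤ 1 := by
    have := hle 0
    rw [zero_add, show c 1 = _ from kummerCoeff_one n δ] at this
    linarith
  -- The first coefficient only gives `δ = O(1/n)`, hence a bounded shift `4nδ`. The second gives `δ
  -- = O(1/n²)`, which makes the shift `O(1/n)`.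
  have l2 : 2 * (n : ℝ) ^ 2 * δ * (1 - δ) ≤ 3 := by
    have := hle 1
    rw [show c (1 + 1) = _ from kummerCoeff_succ n δ 1, kummerCoeff_one] at this
    norm_num at this
    nlinarith
  have hδ2 : δ ≤ 1 / 2 := by nlinarith [hδ.1]
  have l3 : (n : ℝ) ^ 2 * δ ≤ 3 := by
    nlinarith [mul_nonneg (mul_nonneg (sq_nonneg (n : ℝ)) hδ.1) (sub_nonneg.2 hδ2)]
  -- `1 - h (x²)` is an average of the powers `x^{2(j+1)} ≤ x²` with weights `-c (j + 1)`.
  have hbd : ∀ x ∈ Icc (-1 : ℝ) 1, |h (x ^ 2) - 1| ≤ x ^ 2 := by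
    intro x hx
    have hx2 : x ^ 2 ≤ 1 := by nlinarith [hx.1, hx.2]
    have s0 := summable_mul_pow_of_le_div_factorial b0 (x ^ 2)
    have e : h (x ^ 2) - 1 = -∑' j, -c (j + 1) * (x ^ 2) ^ (j + 1) := by
      have := s0.tsum_eq_zero_add
      simp only [hh]
      rw [this, show kummerCoeff n δ 0 = 1 from kummerCoeff_zero n δ, ← tsum_neg]
      simp [hc]
    have hp : ∀ j, -c (j + 1) * (x ^ 2) ^ (j + 1) ≤ -c (j + 1) * x ^ 2 := fun j => by
      refine mul_le_mul_of_nonneg_left ?_ (hnn j)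
      exact pow_le_of_le_one (sq_nonneg x) hx2 (by omega)
    have hp0 : ∀ j, 0 ≤ -c (j + 1) * (x ^ 2) ^ (j + 1) := fun j =>
      mul_nonneg (hnn j) (by positivity)
    have hsx := hsc1.mul_right (x ^ 2)
    rw [e, abs_neg, abs_of_nonneg (tsum_nonneg hp0)]
    calc _ ≤ ∑' j, -c (j + 1) * x ^ 2 :=
          (Summable.of_nonneg_of_le hp0 hp hsx).tsum_le_tsum hp hsx
      _ = x ^ 2 := by rw [tsum_mul_right, htail, one_mul]
  have hh_one : h 1 = 0 := by simpa [hh] using hsum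
  have dg : ∀ x : ℝ, HasDerivAt (fun x : ℝ => exp (-(n * x ^ 2 / 2)))
      (-(n * x) * exp (-(n * x ^ 2 / 2))) x := by
    intro x
    have : HasDerivAt (fun x : ℝ => -(n * x ^ 2 / 2)) (-(n * x)) x :=
      (((hasDerivAt_pow 2 x).const_mul (n : ℝ)).div_const 2).neg.congr_deriv (by push_cast; ring)
    exact this.exp.congr_deriv (mul_comm _ _)
  have dsq : ∀ x : ℝ, HasDerivAt (fun x : ℝ => x ^ 2) (2 * x) x := fun x => by
    simpa using hasDerivAt_pow 2 x
  -- Substituting `e^{-nx²/2} h(x²)` turns Kummer's equation into the oscillator equation with `μ =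
  -- 4nδ`.
  refine ⟨fun x => exp (-(n * x ^ 2 / 2)) * h (x ^ 2),
    fun x => exp (-(n * x ^ 2 / 2)) * (2 * x * h1 (x ^ 2) - n * x * h (x ^ 2)), 4 * n * δ,
    fun x => ?_, fun x => ?_, ?_, ?_, ?_, ?_, fun x hx => ?_⟩
  · refine ((dg x).mul (HasDerivAt.comp x (d0 (x ^ 2)) (dsq x))).congr_deriv ?_
    rw [Function.comp_apply]
    ring
  · have k0 : HasDerivAt (fun x : ℝ => h (x ^ 2)) (h1 (x ^ 2) * (2 * x)) x :=
      HasDerivAt.comp (h₂ := h) x (d0 (x ^ 2)) (dsq x)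
    have k1 : HasDerivAt (fun x : ℝ => h1 (x ^ 2)) (h2 (x ^ 2) * (2 * x)) x :=
      HasDerivAt.comp (h₂ := h1) x (d1 (x ^ 2)) (dsq x)
    have k2 := (((hasDerivAt_id x).const_mul 2).mul k1).sub
      (((hasDerivAt_id x).const_mul (n : ℝ)).mul k0)
    refine HasDerivAt.congr_deriv (f := fun x => exp (-(n * x ^ 2 / 2)) *
      (2 * x * h1 (x ^ 2) - n * x * h (x ^ 2))) ((dg x).mul k2) ?_
    simp only [id]
    linear_combination exp (-(n * x ^ 2 / 2)) * ode (x ^ 2)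
  · simp [hh_one]
  · simp [hh_one]
  · have := hδ.1; positivity
  · rw [le_div_iff₀ (by positivity)]; nlinarith
  · rw [show exp (-(n * x ^ 2 / 2)) * h (x ^ 2) - exp (-(n * x ^ 2 / 2)) =
      (h (x ^ 2) - 1) * exp (-(n * x ^ 2 / 2)) by ring, abs_mul, abs_of_pos (exp_pos _)]
    exact mul_le_mul_of_nonneg_right (hbd x hx) (exp_pos _).le

/-! ### Calculus and integration on the cylinder. -/

theorem isOpenQuotientMap_prodMap_coe :
    IsOpenQuotientMap (Prod.map id (fun y : ℝ => (y : Torus)) : ℝ × ℝ → ℝ × Torus) :=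
  IsOpenQuotientMap.id.prodMap QuotientAddGroup.isOpenQuotientMap_mk

theorem continuous_of_comp_coe {E : Type*} [TopologicalSpace E] {F : ℝ × Torus → E}
    (h : Continuous fun p : ℝ × ℝ => F (p.1, (p.2 : Torus))) : Continuous F :=
  isOpenQuotientMap_prodMap_coe.isQuotientMap.continuous_iff.2 h

theorem contDiff_deriv_fst {g : ℝ × ℝ → ℂ} (hg : ContDiff ℝ ((⊤ : ℕ∞) : WithTop ℕ∞) g) :
    ContDiff ℝ ((⊤ : ℕ∞) : WithTop ℕ∞) fun p : ℝ × ℝ => deriv (fun s => g (s, p.2)) p.1 := by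
  have h : (fun p : ℝ × ℝ => deriv (fun s => g (s, p.2)) p.1) =
      fun p => fderiv ℝ g p ((1 : ℝ), (0 : ℝ)) := by
    funext p
    have h1 : HasDerivAt (fun s : ℝ => (s, p.2)) ((1 : ℝ), (0 : ℝ)) p.1 :=
      (hasDerivAt_id p.1).prodMk (hasDerivAt_const p.1 p.2)
    exact (((hg.differentiable (by simp)) p).hasFDerivAt.comp_hasDerivAt p.1 h1).deriv
  rw [h]
  exact (hg.fderiv_right (by simp)).clm_apply contDiff_const

theorem contDiff_deriv_snd {g : ℝ × ℝ → ℂ} (hg : ContDiff ℝ ((⊤ : ℕ∞) : WithTop ℕ∞) g) :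
    ContDiff ℝ ((⊤ : ℕ∞) : WithTop ℕ∞) fun p : ℝ × ℝ => deriv (fun s => g (p.1, s)) p.2 := by
  have h : (fun p : ℝ × ℝ => deriv (fun s => g (p.1, s)) p.2) =
      fun p => fderiv ℝ g p ((0 : ℝ), (1 : ℝ)) := by
    funext p
    have h1 : HasDerivAt (fun s : ℝ => (p.1, s)) ((0 : ℝ), (1 : ℝ)) p.2 :=
      (hasDerivAt_const p.2 p.1).prodMk (hasDerivAt_id p.2)
    exact (((hg.differentiable (by simp)) p).hasFDerivAt.comp_hasDerivAt p.2 h1).deriv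
  rw [h]
  exact (hg.fderiv_right (by simp)).clm_apply contDiff_const

theorem cylinderMeasure_eq_prod :
    cylinderMeasure = (volume.restrict (Ioo (-1 : ℝ) 1)).prod (volume : Measure Torus) := by
  rw [cylinderMeasure, grushinCylinder, Measure.volume_eq_prod, ← Measure.prod_restrict,
    Measure.restrict_univ]

instance isFiniteMeasure_cylinderMeasure : IsFiniteMeasure cylinderMeasure := by
  rw [cylinderMeasure_eq_prod]; infer_instance

theorem ae_mem_grushinCylinder : ∀ᵐ p ∂cylinderMeasure, p ∈ grushinCylinder :=
  ae_restrict_mem (measurableSet_Ioo.prod MeasurableSet.univ)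

theorem exists_bound_of_continuous {E : Type*} [SeminormedAddCommGroup E] {F : ℝ × Torus → E}
    (hF : Continuous F) : ∃ C, ∀ᵐ p ∂cylinderMeasure, ‖F p‖ ≤ C := by
  obtain ⟨C, hC⟩ := ((isCompact_Icc (a := (-1 : ℝ)) (b := 1)).prod
    (isCompact_univ (X := Torus))).exists_bound_of_continuousOn hF.continuousOn
  refine ⟨C, ae_mem_grushinCylinder.mono fun p hp => hC p ⟨Ioo_subset_Icc_self hp.1, mem_univ _⟩⟩

theorem memLp_of_continuous {F : ℝ × Torus → ℂ} (hF : Continuous F) (q : ENNReal) :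
    MemLp F q cylinderMeasure := by
  obtain ⟨C, hC⟩ := exists_bound_of_continuous hF
  exact MemLp.of_bound hF.aestronglyMeasurable C hC

theorem integrable_of_continuous {F : ℝ × Torus → ℂ} (hF : Continuous F) :
    Integrable F cylinderMeasure :=
  memLp_one_iff_integrable.1 (memLp_of_continuous hF 1)

theorem integral_Ioo_eq_intervalIntegral (F : ℝ → ℂ) :
    ∫ x in Ioo (-1 : ℝ) 1, F x = ∫ x in (-1 : ℝ)..1, F x := by
  rw [intervalIntegral.integral_of_le (by norm_num), integral_Ioc_eq_integral_Ioo]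

theorem integral_cylinder {F : ℝ × Torus → ℂ} (hF : Continuous F) :
    ∫ p, F p ∂cylinderMeasure = ∫ x in Ioo (-1 : ℝ) 1, ∫ y in (0 : ℝ)..(0 + 2 * π), F (x, (y : Torus)) := by
  have h := integrable_of_continuous hF
  rw [cylinderMeasure_eq_prod] at h ⊢
  rw [integral_prod _ h]
  simp_rw [← AddCircle.intervalIntegral_preimage (2 * π) 0]

theorem integral_cylinder_symm {F : ℝ × Torus → ℂ} (hF : Continuous F) :
    ∫ p, F p ∂cylinderMeasure = ∫ y : Torus, ∫ x in (-1 : ℝ)..1, F (x, y) := by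
  have h := integrable_of_continuous hF
  rw [cylinderMeasure_eq_prod] at h ⊢
  rw [integral_prod_symm _ h]
  simp_rw [integral_Ioo_eq_intervalIntegral]

/-! ### Separated modes as weak eigenfunctions. -/

/-- Two integrations by parts with vanishing boundary terms. -/
theorem integral_mul_deriv_two {a b : ℝ} {u u' u'' v v' v'' : ℝ → ℂ}
    (hu : ∀ x, HasDerivAt u (u' x) x) (hu' : ∀ x, HasDerivAt u' (u'' x) x) (hu'' : Continuous u'')
    (hv : ∀ x, HasDerivAt v (v' x) x) (hv' : ∀ x, HasDerivAt v' (v'' x) x) (hv'' : Continuous v'')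
    (hb : u b * v' b - u a * v' a = u' b * v b - u' a * v a) :
    ∫ x in a..b, u x * v'' x = ∫ x in a..b, u'' x * v x := by
  have cu' : Continuous u' := continuous_iff_continuousAt.2 fun x => (hu' x).continuousAt
  have cv' : Continuous v' := continuous_iff_continuousAt.2 fun x => (hv' x).continuousAt
  rw [intervalIntegral.integral_mul_deriv_eq_deriv_mul (fun x _ => hu x) (fun x _ => hv' x)
    (cu'.intervalIntegrable _ _) (hv''.intervalIntegrable _ _),
    intervalIntegral.integral_mul_deriv_eq_deriv_mul (fun x _ => hu' x) (fun x _ => hv x)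
    (hu''.intervalIntegrable _ _) (cv'.intervalIntegrable _ _), hb]
  ring

/-- The function `f(x) e^{iny}`. -/
noncomputable def fourierMode (f : ℝ → ℝ) (n : ℤ) (p : ℝ × Torus) : ℂ := (f p.1 : ℂ) * fourier n p.2

theorem continuous_fourierMode {f : ℝ → ℝ} (hf : Continuous f) (n : ℤ) :
    Continuous (fourierMode f n) := by
  unfold fourierMode; fun_prop

theorem fourier_torus_coe (n : ℤ) (y : ℝ) :
    fourier n (y : Torus) = Complex.exp (Complex.I * n * y) := by
  rw [fourier_coe_apply]
  congr 1
  have : (π : ℂ) ≠ 0 := by exact_mod_cast pi_ne_zero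
  push_cast
  field_simp

theorem hasDerivAt_fourier_torus (n : ℤ) (y : ℝ) :
    HasDerivAt (fun y : ℝ => fourier n (y : Torus)) (Complex.I * n * fourier n (y : Torus)) y := by
  simp only [fourier_torus_coe]
  have h : HasDerivAt (fun y : ℝ => Complex.I * n * (y : ℂ)) (Complex.I * n) y := by
    simpa using (Complex.ofRealCLM.hasDerivAt (x := y)).const_mul (Complex.I * n)
  exact h.cexp.congr_deriv (mul_comm _ _)

theorem IsDirichletTestFunction.continuous {φ : ℝ × Torus → ℂ} (hφ : IsDirichletTestFunction φ) :
    Continuous φ :=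
  continuous_of_comp_coe hφ.smooth.continuous

theorem iteratedDeriv_two_eq (g : ℝ → ℂ) (x : ℝ) : iteratedDeriv 2 g x = deriv (deriv g) x := by
  rw [iteratedDeriv_succ, iteratedDeriv_one]

theorem iteratedDeriv_torus_coe (φ : ℝ × Torus → ℂ) (x y : ℝ) :
    iteratedDeriv 2 (fun s : ℝ => φ (x, (y : Torus) + (s : Torus))) 0 =
      iteratedDeriv 2 (fun s : ℝ => φ (x, (s : Torus))) y := by
  have h := congrFun (iteratedDeriv_comp_const_add 2 (fun s : ℝ => φ (x, (s : Torus))) y) 0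
  simpa using h

theorem IsDirichletTestFunction.continuous_deriv_fst {φ : ℝ × Torus → ℂ}
    (hφ : IsDirichletTestFunction φ) :
    Continuous fun p : ℝ × Torus => iteratedDeriv 2 (fun s : ℝ => φ (s, p.2)) p.1 := by
  refine continuous_of_comp_coe ?_
  simp only [iteratedDeriv_two_eq]
  exact (contDiff_deriv_fst (contDiff_deriv_fst hφ.smooth)).continuous

theorem IsDirichletTestFunction.continuous_deriv_snd {φ : ℝ × Torus → ℂ}
    (hφ : IsDirichletTestFunction φ) :
    Continuous fun p : ℝ × Torus =>
      iteratedDeriv 2 (fun s : ℝ => φ (p.1, p.2 + (s : Torus))) 0 := by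
  refine continuous_of_comp_coe ?_
  simp only [iteratedDeriv_torus_coe]
  simp only [iteratedDeriv_two_eq]
  exact (contDiff_deriv_snd (contDiff_deriv_snd hφ.smooth)).continuous

theorem hasDerivAt_deriv_of_contDiff {g : ℝ → ℂ} (hg : ContDiff ℝ ((⊤ : ℕ∞) : WithTop ℕ∞) g) :
    (∀ x, HasDerivAt g (deriv g x) x) ∧
      (∀ x, HasDerivAt (deriv g) (iteratedDeriv 2 g x) x) ∧ Continuous (iteratedDeriv 2 g) := by
  refine ⟨fun x => (hg.differentiable (by simp) x).hasDerivAt, fun x => ?_, ?_⟩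
  · rw [iteratedDeriv_two_eq, ← iteratedDeriv_one]
    exact (hg.differentiable_iteratedDeriv 1 (by exact_mod_cast ENat.natCast_lt_top 1) x).hasDerivAt
  · exact hg.continuous_iteratedDeriv 2 (WithTop.coe_le_coe.2 le_top)

/-- `f(x) e^{iny}` is a weak eigenfunction of `Δ_G` if `-f'' + n² x² f = λ f` and `f(±1) = 0`. -/
theorem integral_fourierMode_mul_grushinLaplacian {φ : ℝ × Torus → ℂ}
    (hφ : IsDirichletTestFunction φ) {f f' : ℝ → ℝ} {n : ℤ} {l : ℝ}
    (hf : ∀ x, HasDerivAt f (f' x) x)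
    (hf' : ∀ x, HasDerivAt f' (((n : ℝ) ^ 2 * x ^ 2 - l) * f x) x) (h1 : f 1 = 0) (h2 : f (-1) = 0) :
    ∫ p, fourierMode f n p * grushinLaplacian φ p ∂cylinderMeasure =
      -l * ∫ p, fourierMode f n p * φ p ∂cylinderMeasure := by
  have cf : Continuous f := continuous_iff_continuousAt.2 fun x => (hf x).continuousAt
  have cm := continuous_fourierMode cf n
  have cx := hφ.continuous_deriv_fst
  have cy := hφ.continuous_deriv_snd
  have cφ := hφ.continuous
  have ex : ∫ p, fourierMode f n p * iteratedDeriv 2 (fun s : ℝ => φ (s, p.2)) p.1 ∂cylinderMeasure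
      = ∫ p, (((n : ℝ) ^ 2 * p.1 ^ 2 - l : ℝ) : ℂ) * fourierMode f n p * φ p ∂cylinderMeasure := by
    rw [integral_cylinder_symm (by fun_prop), integral_cylinder_symm (by fun_prop)]
    congr 1
    funext y
    obtain ⟨y, rfl⟩ := QuotientAddGroup.mk_surjective y
    have hs : ContDiff ℝ ((⊤ : ℕ∞) : WithTop ℕ∞) fun s : ℝ => φ (s, (y : Torus)) :=
      hφ.smooth.comp (contDiff_id.prodMk contDiff_const)
    obtain ⟨d1, d2, d3⟩ := hasDerivAt_deriv_of_contDiff hs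
    have e1 : ∀ x, HasDerivAt (fun x => (f x : ℂ) * fourier n (y : Torus))
        ((f' x : ℂ) * fourier n (y : Torus)) x := fun x => (hf x).ofReal_comp.mul_const _
    have e2 : ∀ x, HasDerivAt (fun x => (f' x : ℂ) * fourier n (y : Torus))
        (((((n : ℝ) ^ 2 * x ^ 2 - l) * f x : ℝ) : ℂ) * fourier n (y : Torus)) x :=
      fun x => (hf' x).ofReal_comp.mul_const _
    -- Both functions vanish at `x = ±1`, so no condition on the normal derivatives is needed.
    have := integral_mul_deriv_two (a := -1) (b := 1) e1 e2 (by fun_prop) d1 d2 d3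
      (by simp [h1, h2, show φ (1, (y : Torus)) = 0 from hφ.right _,
        show φ (-1, (y : Torus)) = 0 from hφ.left _])
    refine this.trans (intervalIntegral.integral_congr fun x _ => ?_)
    simp only [fourierMode]
    push_cast
    ring_nf
  have ey : ∫ p, fourierMode f n p * ((p.1 : ℂ) ^ 2 *
        iteratedDeriv 2 (fun s : ℝ => φ (p.1, p.2 + (s : Torus))) 0) ∂cylinderMeasure
      = ∫ p, -(((n : ℝ) ^ 2 * p.1 ^ 2 : ℝ) : ℂ) * fourierMode f n p * φ p ∂cylinderMeasure := by
    rw [integral_cylinder (by fun_prop), integral_cylinder (by fun_prop)]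
    congr 1
    funext x
    simp only [iteratedDeriv_torus_coe]
    have hs : ContDiff ℝ ((⊤ : ℕ∞) : WithTop ℕ∞) fun s : ℝ => φ (x, (s : Torus)) :=
      hφ.smooth.comp (contDiff_const.prodMk contDiff_id)
    obtain ⟨d1, d2, d3⟩ := hasDerivAt_deriv_of_contDiff hs
    have e1 := hasDerivAt_fourier_torus n
    have e2 : ∀ y : ℝ, HasDerivAt (fun y : ℝ => Complex.I * n * fourier n (y : Torus))
        (Complex.I * n * (Complex.I * n * fourier n (y : Torus))) y :=
      fun y => (e1 y).const_mul _
    have hp : ((0 + 2 * π : ℝ) : Torus) = ((0 : ℝ) : Torus) := by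
      rw [zero_add]; simp
    have hper : Function.Periodic (fun s : ℝ => φ (x, (s : Torus))) (2 * π) := fun s => by
      simp
    have hdp : deriv (fun s : ℝ => φ (x, (s : Torus))) (0 + 2 * π) =
        deriv (fun s : ℝ => φ (x, (s : Torus))) 0 := by
      rw [← deriv_comp_add_const]
      exact congrArg (fun g => deriv g 0) (funext hper)
    have c2 : Continuous fun y : ℝ => fourier n (y : Torus) :=
      (map_continuous _).comp (AddCircle.continuous_mk' _)
    -- Here the boundary terms cancel by periodicity in `y`.
    have := integral_mul_deriv_two (a := 0) (b := 0 + 2 * π) e1 e2 (by fun_prop) d1 d2 d3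
      (by rw [hdp, hp]; ring)
    have h3 := congrArg (fun z => (f x : ℂ) * (x : ℂ) ^ 2 * z) this
    simp only [← intervalIntegral.integral_const_mul] at h3
    refine (Eq.trans ?_ h3).trans ?_
    · refine intervalIntegral.integral_congr fun y _ => ?_
      simp only [fourierMode]
      ring
    · refine intervalIntegral.integral_congr fun y _ => ?_
      simp only [fourierMode]
      push_cast
      linear_combination (f x : ℂ) * (x : ℂ) ^ 2 * n ^ 2 * fourier n (y : Torus) *
        φ (x, (y : Torus)) * Complex.I_sq
  have i1 := integrable_of_continuous (cm.fun_mul cx)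
  have i2 := integrable_of_continuous (cm.fun_mul
    ((show Continuous fun p : ℝ × Torus => (p.1 : ℂ) ^ 2 by fun_prop).fun_mul cy))
  simp only [grushinLaplacian, mul_add]
  rw [integral_add i1 i2, ex, ey, ← integral_add (integrable_of_continuous (by fun_prop))
    (integrable_of_continuous (by fun_prop)), ← integral_const_mul]
  congr 1
  funext p
  push_cast
  ring

/-! ### Transport on the circle and occupation time. -/

theorem measurableSet_coe_image {J : Set ℝ} (hJ : MeasurableSet J) :
    MeasurableSet ((fun y : ℝ => (y : Torus)) '' J) := by
  -- The projection is injective on each period, and injective continuous images of Borel sets are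
  -- Borel.
  have h : J = ⋃ n : ℤ, J ∩ Ico (0 + n • (2 * π)) (0 + (n + 1) • (2 * π)) := by
    rw [← inter_iUnion, iUnion_Ico_add_zsmul two_pi_pos, inter_univ]
  rw [h, image_iUnion]
  refine MeasurableSet.iUnion fun n => (hJ.inter measurableSet_Ico).image_of_continuousOn_injOn
    (AddCircle.continuous_mk' _).continuousOn fun x hx y hy hxy => ?_
  have e : (0 : ℝ) + (n + 1) • (2 * π) = 0 + n • (2 * π) + 2 * π := by
    rw [add_zsmul, one_zsmul, add_assoc]
  rw [e] at hx hy
  exact (AddCircle.coe_eq_coe_iff_of_mem_Ico hx.2 hy.2).1 hxy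

/-- The time spent in `I` by the particle that starts at `y` and moves with unit speed. -/
noncomputable def occupationTime (I : Set Torus) (T : ℝ) (y : Torus) : ℝ :=
  ∫ t in (0 : ℝ)..T, I.indicator (fun _ => (1 : ℝ)) (y + (t : Torus))

theorem intervalIntegrable_indicator_coe {I : Set Torus} (hI : MeasurableSet I) (y : Torus) (a b : ℝ) :
    IntervalIntegrable (fun t : ℝ => I.indicator (fun _ => (1 : ℝ)) (y + (t : Torus))) volume a b := by
  have hm : Measurable fun t : ℝ => I.indicator (fun _ => (1 : ℝ)) (y + (t : Torus)) :=
    (measurable_const.indicator hI).comp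
      (continuous_const.add (AddCircle.continuous_mk' _)).measurable
  refine (intervalIntegrable_const (c := (1 : ℝ))).mono_fun hm.aestronglyMeasurable
    (Eventually.of_forall fun t => ?_)
  exact (norm_indicator_le_norm_self _ _).trans (by simp)

/-- Integration in time smooths the jumps of the indicator: shifting the start by `z` gives the
primitive at `z + T` minus the primitive at `z`. Continuity is what lets a peaked profile recover
the value at its peak. -/
theorem continuous_occupationTime {I : Set Torus} (hI : MeasurableSet I) (T : ℝ) (y : ℝ) :
    Continuous fun z : ℝ => occupationTime I T ((y + z : ℝ) : Torus) := by
  have hint := intervalIntegrable_indicator_coe hI y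
  have h : (fun z : ℝ => occupationTime I T ((y + z : ℝ) : Torus)) = fun z =>
      (∫ t in (0 : ℝ)..(z + T), I.indicator (fun _ => (1 : ℝ)) ((y : Torus) + (t : Torus))) -
      ∫ t in (0 : ℝ)..z, I.indicator (fun _ => (1 : ℝ)) ((y : Torus) + (t : Torus)) := by
    funext z
    rw [intervalIntegral.integral_interval_sub_left (hint _ _) (hint _ _), occupationTime]
    have := intervalIntegral.integral_comp_add_left
      (fun t : ℝ => I.indicator (fun _ => (1 : ℝ)) ((y : Torus) + (t : Torus))) z (a := 0) (b := T)
    rw [add_zero] at this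
    rw [← this]
    refine intervalIntegral.integral_congr fun t _ => ?_
    simp only [AddCircle.coe_add, add_assoc]
  rw [h]
  have hc := intervalIntegral.continuous_primitive hint 0
  exact (hc.comp (continuous_id.add continuous_const)).sub hc

theorem occupationTime_le {I : Set Torus} (hI : MeasurableSet I) {T s y : ℝ} (hs : 0 ≤ s)
    (hsT : s ≤ T) (h : ∀ t ∈ Icc 0 s, ((y + t : ℝ) : Torus) ∉ I) :
    occupationTime I T y ≤ T - s := by
  have hint := intervalIntegrable_indicator_coe hI y
  rw [occupationTime, ← intervalIntegral.integral_add_adjacent_intervals (hint 0 s) (hint s T)]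
  have h1 : ∫ t in (0 : ℝ)..s, I.indicator (fun _ => (1 : ℝ)) ((y : Torus) + (t : Torus)) = 0 := by
    rw [intervalIntegral.integral_congr (g := fun _ => (0 : ℝ)), intervalIntegral.integral_zero]
    intro t ht
    rw [uIcc_of_le hs] at ht
    exact indicator_of_notMem (h t ht) _
  have h2 : ∫ t in s..T, I.indicator (fun _ => (1 : ℝ)) ((y : Torus) + (t : Torus)) ≤
      ∫ t in s..T, (1 : ℝ) :=
    intervalIntegral.integral_mono_on hsT (hint s T) intervalIntegrable_const
      fun t _ => indicator_le_self' (fun _ _ => zero_le_one) _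
  rw [h1, zero_add]
  simpa using h2

/-! ### Concentrating trigonometric polynomials. -/

/-- The trigonometric polynomial `((1 + e^{i(y - y₀)}) / 2)^m`. -/
noncomputable def trigPeak (y₀ : ℝ) (m : ℕ) (y : Torus) : ℂ :=
  ∑ j ∈ Finset.range (m + 1), ((m.choose j : ℂ) / 2 ^ m * fourier (-j) (y₀ : Torus)) * fourier j y

theorem norm_sq_trigPeak (y₀ : ℝ) (m : ℕ) (z : ℝ) :
    ‖trigPeak y₀ m ((y₀ + z : ℝ) : Torus)‖ ^ 2 = ((1 + cos z) / 2) ^ m := by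
  have h : trigPeak y₀ m ((y₀ + z : ℝ) : Torus) = ((Complex.exp (Complex.I * z) + 1) / 2) ^ m := by
    rw [div_pow, add_pow, trigPeak, Finset.sum_div]
    refine Finset.sum_congr rfl fun j _ => ?_
    rw [mul_assoc]
    rw [fourier_torus_coe, fourier_torus_coe, ← Complex.exp_add, ← Complex.exp_nat_mul, one_pow]
    rw [show Complex.I * ((-j : ℤ) : ℂ) * y₀ + Complex.I * ((j : ℤ) : ℂ) * ((y₀ + z : ℝ) : ℂ) =
      j * (Complex.I * z) by push_cast; ring]
    ring
  rw [h, norm_pow, ← pow_mul, mul_comm m 2, pow_mul]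
  congr 1
  rw [norm_div, div_pow, ← Complex.normSq_eq_norm_sq, mul_comm Complex.I, Complex.exp_mul_I,
    ← Complex.ofReal_cos, ← Complex.ofReal_sin, Complex.normSq_apply]
  simp only [Complex.add_re, Complex.add_im, Complex.mul_re, Complex.mul_im, Complex.ofReal_re,
    Complex.ofReal_im, Complex.I_re, Complex.I_im, Complex.one_re, Complex.one_im,
    Complex.norm_ofNat]
  linear_combination (1 / 4) * sin_sq_add_cos_sq z

theorem integral_torus_eq (y₀ : ℝ) (F : Torus → ℝ) :
    ∫ y : Torus, F y = ∫ z in Icc (-π) π, F ((y₀ + z : ℝ) : Torus) := by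
  rw [← AddCircle.intervalIntegral_preimage (2 * π) (y₀ + -π) F, integral_Icc_eq_integral_Ioc,
    ← intervalIntegral.integral_of_le (by linarith [pi_pos]),
    intervalIntegral.integral_comp_add_left (fun z : ℝ => F (z : Torus)) y₀]
  congr 1
  ring

/-- Trigonometric polynomials concentrate at a point. -/
theorem tendsto_trigPeak_ratio (y₀ : ℝ) {H : Torus → ℝ}
    (hH : Continuous fun z : ℝ => H ((y₀ + z : ℝ) : Torus)) :
    Tendsto (fun m => (∫ y, ‖trigPeak y₀ m y‖ ^ 2)⁻¹ * ∫ y, ‖trigPeak y₀ m y‖ ^ 2 * H y) atTop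
      (𝓝 (H y₀)) := by
  -- `|trigPeak|²` is the `m`-th power of `(1 + cos z)/2`, whose only maximum on `[-π, π]` is at
  -- `0`.
  have h := tendsto_setIntegral_pow_smul_of_unique_maximum_of_isCompact_of_continuousOn
    (μ := (volume : Measure ℝ)) (g := fun z : ℝ => H ((y₀ + z : ℝ) : Torus)) (x₀ := 0)
    (s := Icc (-π) π) (c := fun z => (1 + cos z) / 2) isCompact_Icc (by fun_prop)
    (fun z hz hz0 => ?_) (fun z _ => by linarith [neg_one_le_cos z]) (by simp) ?_ hH.continuousOn
  · simp only [add_zero] at h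
    refine h.congr fun m => ?_
    rw [integral_torus_eq y₀, integral_torus_eq y₀]
    simp only [norm_sq_trigPeak, smul_eq_mul]
  · rw [cos_zero]
    have : cos z < 1 := by
      refine lt_of_le_of_ne (cos_le_one z) fun hc => hz0 ?_
      exact (cos_eq_one_iff_of_lt_of_lt (by linarith [hz.1, pi_pos]) (by linarith [hz.2, pi_pos])).1 hc
    linarith
  · rw [interior_Icc, closure_Ioo (by linarith [pi_pos])]
    constructor <;> linarith [pi_pos]

theorem continuous_trigPeak (y₀ : ℝ) (m : ℕ) : Continuous (trigPeak y₀ m) := by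
  unfold trigPeak; fun_prop

theorem integral_norm_sq_trigPeak_pos (y₀ : ℝ) (m : ℕ) : 0 < ∫ y, ‖trigPeak y₀ m y‖ ^ 2 := by
  refine Continuous.integral_pos_of_hasCompactSupport_nonneg_nonzero
    ((continuous_trigPeak y₀ m).norm.pow 2) (HasCompactSupport.of_compactSpace _)
    (fun y => by positivity) (x := (y₀ : Torus)) ?_
  have := norm_sq_trigPeak y₀ m 0
  rw [add_zero] at this
  simp only [this]
  simp

/-- Integrating the transported profile over `I` and over time. -/
theorem integral_transport_eq {I : Set Torus} (hI : MeasurableSet I) {T : ℝ} (hT : 0 ≤ T)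
    {q : Torus → ℝ} (hq : Continuous q) :
    ∫ t in (0 : ℝ)..T, ∫ y in I, q (y - (t : Torus)) = ∫ z, q z * occupationTime I T z := by
  have h1 : ∀ t : ℝ, ∫ y in I, q (y - (t : Torus)) =
      ∫ z, q z * I.indicator (fun _ => (1 : ℝ)) (z + (t : Torus)) := fun t => by
    rw [← integral_indicator hI,
      ← integral_add_right_eq_self (μ := (volume : Measure Torus)) _ (t : Torus)]
    congr 1
    funext z
    by_cases hz : z + (t : Torus) ∈ I <;> simp [hz]
  simp only [h1]
  rw [intervalIntegral.integral_of_le hT, integral_integral_swap]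
  · congr 1
    funext z
    rw [integral_const_mul, occupationTime, intervalIntegral.integral_of_le hT]
  · obtain ⟨C, hC⟩ := isCompact_univ.exists_bound_of_continuousOn hq.continuousOn
    have hm : Measurable (Function.uncurry fun (t : ℝ) (z : Torus) =>
        q z * I.indicator (fun _ => (1 : ℝ)) (z + (t : Torus))) := by
      refine (hq.measurable.comp measurable_snd).mul ((measurable_const.indicator hI).comp ?_)
      exact (continuous_snd.add ((AddCircle.continuous_mk' _).comp continuous_fst)).measurable
    refine Integrable.of_bound hm.aestronglyMeasurable C (Eventually.of_forall fun p => ?_)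
    rw [Function.uncurry, norm_mul]
    have : ‖I.indicator (fun _ => (1 : ℝ)) (p.2 + (p.1 : Torus))‖ ≤ 1 :=
      (norm_indicator_le_norm_self _ _).trans (by simp)
    calc _ ≤ ‖q p.2‖ * 1 := by gcongr
      _ ≤ C := by simpa using hC p.2 (mem_univ _)

/-- By Fubini the left side averages the occupation time against `|trigPeak|²`. The normalised
average tends to its value at `y₀`, which is at most `T - s < ε`. -/
theorem exists_trigPeak_transport_le {I : Set Torus} (hI : MeasurableSet I) {T s y₀ ε : ℝ}
    (hs : 0 ≤ s) (hsT : s ≤ T) (h : ∀ t ∈ Icc 0 s, ((y₀ + t : ℝ) : Torus) ∉ I) (hε : T - s < ε) :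
    ∃ m, ∫ t in (0 : ℝ)..T, ∫ y in I, ‖trigPeak y₀ m (y - (t : Torus))‖ ^ 2 ≤
      ε * ∫ y, ‖trigPeak y₀ m y‖ ^ 2 := by
  have ht := tendsto_trigPeak_ratio y₀ (continuous_occupationTime hI T y₀)
  obtain ⟨m, hm⟩ := (ht.eventually (gt_mem_nhds ((occupationTime_le hI hs hsT h).trans_lt hε))).exists
  refine ⟨m, ?_⟩
  have hpos := integral_norm_sq_trigPeak_pos y₀ m
  rw [integral_transport_eq hI (hs.trans hsT) (q := fun y => ‖trigPeak y₀ m y‖ ^ 2)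
    ((continuous_trigPeak y₀ m).norm.pow 2)]
  rw [inv_mul_lt_iff₀ hpos] at hm
  linarith

/-- Closed arcs of length close to `T₀` that avoid `I`. -/
theorem exists_arc_of_le_gapLength {I : Set Torus} {T₀ ε : ℝ} (hT₀ : 0 < T₀)
    (hT : T₀ ≤ gapLength (Ioo (-1 : ℝ) 1 ×ˢ I)) (hε : 0 < ε) :
    ∃ s y : ℝ, 0 ≤ s ∧ s ≤ T₀ ∧ T₀ - s < ε ∧ ∀ t ∈ Icc 0 s, ((y + t : ℝ) : Torus) ∉ I := by
  have hne : {s : ℝ | 0 ≤ s ∧ s ≤ 2 * π ∧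
      ∃ y : ℝ, ∀ r ∈ Icc y (y + s), ((0 : ℝ), (r : Torus)) ∉ Ioo (-1 : ℝ) 1 ×ˢ I}.Nonempty := by
    -- If no arc existed, the supremum would take its default value `0`, contradicting `0 < T₀`.
    by_contra hemp
    rw [not_nonempty_iff_eq_empty] at hemp
    rw [gapLength, hemp, sSup_empty] at hT
    exact hT₀.not_ge hT
  obtain ⟨s, ⟨hs0, -, y, hy⟩, hs⟩ := exists_lt_of_lt_csSup hne
    (show T₀ - ε < gapLength (Ioo (-1 : ℝ) 1 ×ˢ I) by linarith)
  refine ⟨min s T₀, y, le_min hs0 hT₀.le, min_le_right _ _, ?_, fun t ht hI => ?_⟩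
  · rcases min_cases s T₀ with h | h <;> rw [h.1] <;> linarith
  · exact hy (y + t) ⟨by linarith [ht.1], by linarith [ht.2, min_le_left s T₀]⟩
      ⟨by simp, hI⟩

/-! ### Finite packets of modes and their evolution. -/

/-- The superposition `∑ a_j e^{-i l_j t} F_j` of modes. -/
noncomputable def modePacket (s : Finset ℕ) (a : ℕ → ℂ) (F : ℕ → ℝ × Torus → ℂ) (l : ℕ → ℝ) (t : ℝ)
    (p : ℝ × Torus) : ℂ :=
  ∑ j ∈ s, a j * Complex.exp (Complex.I * ((-(l j * t) : ℝ) : ℂ)) * F j p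

theorem modePacket_const_mul (s : Finset ℕ) (c : ℂ) (a : ℕ → ℂ) (F : ℕ → ℝ × Torus → ℂ)
    (l : ℕ → ℝ) (t : ℝ) (p : ℝ × Torus) :
    modePacket s (fun j => c * a j) F l t p = c * modePacket s a F l t p := by
  simp only [modePacket, Finset.mul_sum, mul_assoc]

theorem continuous_modePacket (s : Finset ℕ) (a : ℕ → ℂ) {F : ℕ → ℝ × Torus → ℂ}
    (hF : ∀ j, Continuous (F j)) (l : ℕ → ℝ) (t : ℝ) : Continuous (modePacket s a F l t) := by
  unfold modePacket; fun_prop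

theorem exists_isGrushinEvolution_modePacket (s : Finset ℕ) (a : ℕ → ℂ) {F : ℕ → ℝ × Torus → ℂ}
    (hF : ∀ j, Continuous (F j)) {l : ℕ → ℝ}
    (hl : ∀ j φ, IsDirichletTestFunction φ → ∫ p, F j p * grushinLaplacian φ p ∂cylinderMeasure =
      -l j * ∫ p, F j p * φ p ∂cylinderMeasure) :
    ∃ u : ℝ → L2Cylinder, IsGrushinEvolution (u 0) u ∧
      ∀ t, u t =ᵐ[cylinderMeasure] modePacket s a F l t := by
  set u : ℝ → L2Cylinder := fun t =>
    ∑ j ∈ s, (a j * Complex.exp (Complex.I * ((-(l j * t) : ℝ) : ℂ))) •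
      (memLp_of_continuous (hF j) 2).toLp with hu
  have hae : ∀ t, u t =ᵐ[cylinderMeasure] modePacket s a F l t := fun t => by
    have h1 : ∀ᵐ p ∂cylinderMeasure, ∀ j ∈ s,
        ((a j * Complex.exp (Complex.I * ((-(l j * t) : ℝ) : ℂ))) •
          (memLp_of_continuous (hF j) 2).toLp : L2Cylinder) p =
        a j * Complex.exp (Complex.I * ((-(l j * t) : ℝ) : ℂ)) * F j p := by
      refine (ae_ball_iff s.countable_toSet).2 fun j _ => ?_
      filter_upwards [Lp.coeFn_smul (a j * Complex.exp (Complex.I * ((-(l j * t) : ℝ) : ℂ)))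
        (memLp_of_continuous (hF j) 2).toLp, (memLp_of_continuous (hF j) 2).coeFn_toLp] with p h1 h2
      rw [h1, Pi.smul_apply, h2, smul_eq_mul]
    filter_upwards [Lp.coeFn_finsetSum s fun j =>
      ((a j * Complex.exp (Complex.I * ((-(l j * t) : ℝ) : ℂ))) •
        (memLp_of_continuous (hF j) 2).toLp : L2Cylinder), h1] with p h2 h1
    rw [hu, h2, Finset.sum_apply, modePacket]
    exact Finset.sum_congr rfl h1
  have hint : ∀ (g : ℝ × Torus → ℂ), Continuous g → ∀ t, ∫ p, u t p * g p ∂cylinderMeasure =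
      ∑ j ∈ s, a j * Complex.exp (Complex.I * ((-(l j * t) : ℝ) : ℂ)) *
        ∫ p, F j p * g p ∂cylinderMeasure := fun g hg t => by
    have h1 : ∫ p, u t p * g p ∂cylinderMeasure = ∫ p, ∑ j ∈ s,
        a j * Complex.exp (Complex.I * ((-(l j * t) : ℝ) : ℂ)) * (F j p * g p) ∂cylinderMeasure := by
      refine integral_congr_ae ((hae t).mono fun p hp => ?_)
      simp only [hp, modePacket, Finset.sum_mul, mul_assoc]
    rw [h1, integral_finsetSum _ fun j _ =>
      ((integrable_of_continuous ((hF j).fun_mul hg)).const_mul _)]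
    exact Finset.sum_congr rfl fun j _ => integral_const_mul _ _
  refine ⟨u, ⟨by fun_prop, rfl, fun φ hφ t => ?_⟩, hae⟩
  have hc : Continuous (grushinLaplacian φ) := by
    have cx := hφ.continuous_deriv_fst
    have cy := hφ.continuous_deriv_snd
    unfold grushinLaplacian
    fun_prop
  simp only [hint φ hφ.continuous, hint _ hc, Finset.mul_sum]
  refine HasDerivAt.fun_sum fun j _ => ?_
  have h1 : HasDerivAt (fun t : ℝ => Complex.I * ((-(l j * t) : ℝ) : ℂ)) (Complex.I * (-l j)) t := by
    have h2 : HasDerivAt (fun t : ℝ => -(l j * t)) (-(l j)) t := by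
      simpa using ((hasDerivAt_id t).const_mul (l j)).fun_neg
    simpa using h2.ofReal_comp.const_mul Complex.I
  refine ((h1.cexp.const_mul (a j)).mul_const _).congr_deriv ?_
  rw [hl j φ hφ]
  ring

theorem norm_sq_eq_integral_of_ae_eq {v : L2Cylinder} {F : ℝ × Torus → ℂ}
    (h : v =ᵐ[cylinderMeasure] F) : ‖v‖ ^ 2 = ∫ p, ‖F p‖ ^ 2 ∂cylinderMeasure := by
  have h1 : ((‖v‖ ^ 2 : ℝ) : ℂ) = ((∫ p, ‖v p‖ ^ 2 ∂cylinderMeasure : ℝ) : ℂ) := by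
    rw [← integral_complex_ofReal]
    have := inner_self_eq_norm_sq_to_K (𝕜 := ℂ) v
    rw [L2.inner_def] at this
    simp only [inner_self_eq_norm_sq_to_K] at this
    push_cast
    exact this.symm
  rw [Complex.ofReal_inj.1 h1]
  exact integral_congr_ae (h.mono fun p hp => by simp only [hp])

theorem normSqOn_of_ae_eq {ω : Set (ℝ × Torus)} {v : L2Cylinder} {F : ℝ × Torus → ℂ}
    (h : v =ᵐ[cylinderMeasure] F) : normSqOn ω v = ∫ p in ω, ‖F p‖ ^ 2 ∂cylinderMeasure :=
  integral_congr_ae ((ae_restrict_of_ae h).mono fun p hp => by simp only [hp])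

/-! ### Gaussian asymptotics of the packets. -/

/-- The Gaussian `e^{-N x² / 2}`. -/
noncomputable def gaussianProfile (N : ℕ) (x : ℝ) : ℝ := exp (-(N * x ^ 2 / 2))

theorem sq_mul_gaussianProfile_le {N : ℕ} (hN : 1 ≤ N) (x : ℝ) :
    x ^ 2 * gaussianProfile N x ≤ 2 / N := by
  have hN' : (0 : ℝ) < N := by exact_mod_cast hN
  have h := add_one_le_exp (N * x ^ 2 / 2)
  rw [gaussianProfile, exp_neg, ← div_eq_mul_inv, div_le_div_iff₀ (exp_pos _) hN']
  nlinarith [sq_nonneg x]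

theorem gaussianProfile_le_one (N : ℕ) (x : ℝ) : gaussianProfile N x ≤ 1 :=
  exp_le_one_iff.2 (by have : 0 ≤ N * x ^ 2 / 2 := by positivity
                       linarith)

theorem abs_gaussianProfile_sub_le {N : ℕ} (hN : 1 ≤ N) (j : ℕ) (x : ℝ) :
    |gaussianProfile (N + j) x - gaussianProfile N x| ≤ j / N := by
  have hN' : (0 : ℝ) < N := by exact_mod_cast hN
  have h : gaussianProfile (N + j) x = gaussianProfile N x * exp (-(j * x ^ 2 / 2)) := by
    rw [gaussianProfile, gaussianProfile, ← exp_add]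
    congr 1; push_cast; ring
  have h1 := add_one_le_exp (-(j * x ^ 2 / 2))
  have h2 : exp (-(j * x ^ 2 / 2)) ≤ 1 := exp_le_one_iff.2 (by
    have : 0 ≤ j * x ^ 2 / 2 := by positivity
    linarith)
  have h3 := sq_mul_gaussianProfile_le hN x
  have h0 : 0 < gaussianProfile N x := exp_pos _
  rw [h, abs_sub_comm, abs_of_nonneg (by nlinarith)]
  calc gaussianProfile N x - gaussianProfile N x * exp (-(j * x ^ 2 / 2))
      ≤ gaussianProfile N x * (j * x ^ 2 / 2) := by nlinarith
    _ = j / 2 * (x ^ 2 * gaussianProfile N x) := by ring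
    _ ≤ j / 2 * (2 / N) := by gcongr
    _ = j / N := by ring

/-- Three errors add up: `2/N` from ground state to Gaussian, `j/N` from changing the width of the
Gaussian, and `12T/N` from the residual phase `e^{-iμt}`. -/
theorem norm_mul_exp_sub_gaussianProfile_le {N j : ℕ} (hN : 1 ≤ N) {x f μ t T : ℝ}
    (hf : |f - gaussianProfile (N + j) x| ≤ x ^ 2 * gaussianProfile (N + j) x)
    (hμ : 0 ≤ μ) (hμN : μ ≤ 12 / (N + j : ℕ)) (ht : 0 ≤ t) (htT : t ≤ T) :
    ‖(f : ℂ) * Complex.exp (Complex.I * ((-(μ * t) : ℝ) : ℂ)) - gaussianProfile N x‖ ≤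
      (2 + j + 12 * T) / N := by
  have hN' : (0 : ℝ) < N := by exact_mod_cast hN
  have hNj : (N : ℝ) ≤ (N + j : ℕ) := by push_cast; linarith [(Nat.cast_nonneg j : (0 : ℝ) ≤ j)]
  have h1 : |f - gaussianProfile N x| ≤ 2 / N + j / N := by
    refine (abs_sub_le f (gaussianProfile (N + j) x) _).trans (add_le_add ?_
      (abs_gaussianProfile_sub_le hN j x))
    refine (hf.trans (sq_mul_gaussianProfile_le (by omega) x)).trans ?_
    gcongr
  have h2 : ‖Complex.exp (Complex.I * ((-(μ * t) : ℝ) : ℂ)) - 1‖ ≤ 12 * T / N := by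
    refine norm_exp_I_mul_ofReal_sub_one_le.trans ?_
    rw [norm_neg, Real.norm_eq_abs, abs_of_nonneg (by positivity)]
    calc μ * t ≤ 12 / (N + j : ℕ) * T := by gcongr
      _ ≤ 12 / N * T := by
        have : 0 ≤ T := ht.trans htT
        gcongr
      _ = _ := by ring
  have h3 : (f : ℂ) * Complex.exp (Complex.I * ((-(μ * t) : ℝ) : ℂ)) - gaussianProfile N x =
      ((f - gaussianProfile N x : ℝ) : ℂ) * Complex.exp (Complex.I * ((-(μ * t) : ℝ) : ℂ)) +
      (gaussianProfile N x : ℂ) * (Complex.exp (Complex.I * ((-(μ * t) : ℝ) : ℂ)) - 1) := by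
    push_cast; ring
  have h0 : ‖(gaussianProfile N x : ℂ)‖ ≤ 1 := by
    rw [Complex.norm_real, Real.norm_eq_abs, gaussianProfile, abs_of_pos (exp_pos _)]
    exact gaussianProfile_le_one N x
  rw [h3]
  refine (norm_add_le _ _).trans ?_
  rw [norm_mul, norm_mul, Complex.norm_real, mul_comm Complex.I, Complex.norm_exp_ofReal_mul_I,
    mul_one, mul_comm _ Complex.I, Real.norm_eq_abs]
  calc _ ≤ (2 / N + j / N : ℝ) + 1 * (12 * T / N) := by gcongr
    _ = _ := by ring

/-- On `(0, 1/N)` the integrand is at least `e⁻¹ ≥ 1/3`. This is crude, but it beats the squared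
error `O(N⁻²)`. -/
theorem inv_le_integral_gaussianProfile_sq {N : ℕ} (hN : 1 ≤ N) :
    1 / (3 * N) ≤ ∫ x in Ioo (-1 : ℝ) 1, gaussianProfile N x ^ 2 := by
  have hN' : (1 : ℝ) ≤ N := by exact_mod_cast hN
  have hc : Continuous fun x => gaussianProfile N x ^ 2 := by unfold gaussianProfile; fun_prop
  have hi : IntegrableOn (fun x => gaussianProfile N x ^ 2) (Ioo (-1 : ℝ) 1) :=
    (hc.integrableOn_Icc (a := -1) (b := 1)).mono_set Ioo_subset_Icc_self
  have hs : Ioo (0 : ℝ) (1 / N) ⊆ Ioo (-1) 1 := by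
    refine Ioo_subset_Ioo (by norm_num) ?_
    rw [div_le_one (by linarith)]; exact hN'
  calc 1 / (3 * N : ℝ) = ∫ x in Ioo (0 : ℝ) (1 / N), (1 / 3 : ℝ) := by
        rw [setIntegral_const, Real.volume_real_Ioo_of_le (by positivity), smul_eq_mul]
        field_simp; ring
    _ ≤ ∫ x in Ioo (0 : ℝ) (1 / N), gaussianProfile N x ^ 2 := by
        refine setIntegral_mono_on (by simp) (hi.mono_set hs) measurableSet_Ioo fun x hx => ?_
        have h1 : N * x ^ 2 ≤ 1 := by
          have h2 : x * N ≤ 1 := by have := hx.2.le; rwa [le_div_iff₀ (by linarith)] at this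
          have h3 : x ≤ 1 := by nlinarith [hx.1]
          nlinarith [hx.1]
        rw [gaussianProfile, ← exp_nat_mul]
        have h4 : exp (-1) ≤ exp ((2 : ℕ) * -(N * x ^ 2 / 2)) := exp_le_exp.2 (by push_cast; linarith)
        refine le_trans ?_ h4
        rw [exp_neg, one_div]
        exact inv_anti₀ (exp_pos _) (by linarith [exp_one_lt_d9])
    _ ≤ _ := setIntegral_mono_set hi (Eventually.of_forall fun x => sq_nonneg _) hs.eventuallyLE

theorem setIntegral_cylinder_mul (I : Set Torus) (g : ℝ → ℝ) (q : Torus → ℝ) :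
    ∫ p in Ioo (-1 : ℝ) 1 ×ˢ I, g p.1 * q p.2 ∂cylinderMeasure =
      (∫ x in Ioo (-1 : ℝ) 1, g x) * ∫ y in I, q y := by
  rw [cylinderMeasure_eq_prod, setIntegral_prod_mul, Measure.restrict_restrict measurableSet_Ioo,
    inter_self]

theorem integral_cylinder_mul (g : ℝ → ℝ) (q : Torus → ℝ) :
    ∫ p, g p.1 * q p.2 ∂cylinderMeasure = (∫ x in Ioo (-1 : ℝ) 1, g x) * ∫ y, q y := by
  rw [cylinderMeasure_eq_prod, integral_prod_mul]

/-- The constant `K` may depend on the packet and on `T`, but not on `N`: the packet is fixed while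
the carrier frequency grows. -/
theorem exists_norm_modePacket_sub_le (s : Finset ℕ) (a : ℕ → ℂ) {T : ℝ} {f : ℕ → ℝ → ℝ}
    {μ : ℕ → ℝ} (hμ : ∀ n, 1 ≤ n → 0 ≤ μ n) (hμn : ∀ n, 1 ≤ n → μ n ≤ 12 / n)
    (hf : ∀ n, 1 ≤ n → ∀ x ∈ Icc (-1 : ℝ) 1,
      |f n x - gaussianProfile n x| ≤ x ^ 2 * gaussianProfile n x) :
    ∃ K, ∀ N, 1 ≤ N → ∀ t ∈ Icc 0 T, ∀ x ∈ Icc (-1 : ℝ) 1, ∀ y : Torus,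
      ‖modePacket s a (fun j => fourierMode (f (N + j)) (N + j : ℕ))
          (fun j => (N + j : ℕ) + μ (N + j)) t (x, y) -
        fourier N (y - (t : Torus)) *
          (gaussianProfile N x * ∑ j ∈ s, a j * fourier j (y - (t : Torus)))‖ ≤ K / N := by
  refine ⟨∑ j ∈ s, ‖a j‖ * (2 + j + 12 * T), fun N hN t ht x hx y => ?_⟩
  obtain ⟨y, rfl⟩ := QuotientAddGroup.mk_surjective y
  have h : modePacket s a (fun j => fourierMode (f (N + j)) (N + j : ℕ))
          (fun j => (N + j : ℕ) + μ (N + j)) t (x, (y : Torus)) -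
        fourier N ((y : Torus) - (t : Torus)) *
          (gaussianProfile N x * ∑ j ∈ s, a j * fourier j ((y : Torus) - (t : Torus))) =
      ∑ j ∈ s, a j * fourier (N + j : ℕ) ((y : Torus) - (t : Torus)) *
        ((f (N + j) x : ℂ) * Complex.exp (Complex.I * ((-(μ (N + j) * t) : ℝ) : ℂ)) -
          gaussianProfile N x) := by
    rw [modePacket, Finset.mul_sum, Finset.mul_sum, ← Finset.sum_sub_distrib]
    refine Finset.sum_congr rfl fun j _ => ?_
    have e1 : (fourier ((N + j : ℕ) : ℤ) ((y : Torus) - (t : Torus)) : ℂ) =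
        fourier (N : ℤ) ((y : Torus) - (t : Torus)) * fourier (j : ℤ) ((y : Torus) - (t : Torus)) := by
      rw [← fourier_add]; push_cast; rfl
    -- The leading part `n` of the eigenvalue becomes the translation `y ↦ y - t`; only the slow
    -- phase `e^{-iμt}` is left.
    have e2 : Complex.exp (Complex.I * ((-(((N + j : ℕ) + μ (N + j)) * t) : ℝ) : ℂ)) *
        fourier ((N + j : ℕ) : ℤ) (y : Torus) = fourier ((N + j : ℕ) : ℤ) ((y : Torus) - (t : Torus)) *
          Complex.exp (Complex.I * ((-(μ (N + j) * t) : ℝ) : ℂ)) := by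
      rw [← AddCircle.coe_sub, fourier_torus_coe, fourier_torus_coe, ← Complex.exp_add,
        ← Complex.exp_add]
      congr 1; push_cast; ring
    rw [fourierMode]
    linear_combination (a j * f (N + j) x) * e2 + a j * gaussianProfile N x * e1
  refine (congrArg norm h).trans_le ((norm_sum_le _ _).trans ?_)
  rw [Finset.sum_div]
  refine Finset.sum_le_sum fun j _ => ?_
  rw [norm_mul, norm_mul, fourier_apply, Circle.norm_coe, mul_one, mul_div_assoc]
  gcongr
  exact norm_mul_exp_sub_gaussianProfile_le hN (hf _ (by omega) x hx) (hμ _ (by omega))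
    (hμn _ (by omega)) ht.1 ht.2

/-! ### Normalised packets and the failure of observability. -/

theorem IsHorizontalStrips.exists_measurableSet {ω : Set (ℝ × Torus)} (hω : IsHorizontalStrips ω) :
    ∃ I : Set Torus, MeasurableSet I ∧ ω = Ioo (-1 : ℝ) 1 ×ˢ I := by
  obtain ⟨N, J, hJ, rfl⟩ := hω
  exact ⟨_, MeasurableSet.iUnion fun k => measurableSet_coe_image (hJ k).measurableSet, rfl⟩

theorem norm_sq_le_two_mul_add {a b : ℂ} {k : ℝ} (h : ‖a - b‖ ≤ k) :
    ‖a‖ ^ 2 ≤ 2 * ‖b‖ ^ 2 + 2 * k ^ 2 := by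
  have h1 : ‖a‖ ≤ ‖b‖ + k := by
    have := norm_le_norm_add_norm_sub' a b
    linarith
  nlinarith [sq_nonneg (‖b‖ - k), norm_nonneg a, norm_nonneg b]

theorem integrable_of_continuous_real {F : ℝ × Torus → ℝ} (hF : Continuous F) :
    Integrable F cylinderMeasure := by
  obtain ⟨C, hC⟩ := exists_bound_of_continuous hF
  exact Integrable.of_bound hF.aestronglyMeasurable C hC

theorem continuous_setIntegral_sub {I : Set Torus} {q : Torus → ℝ} (hq : Continuous q) :
    Continuous fun t : ℝ => ∫ y in I, q (y - (t : Torus)) := by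
  obtain ⟨C, hC⟩ := isCompact_univ.exists_bound_of_continuousOn hq.continuousOn
  refine continuous_of_dominated (bound := fun _ => C) (fun t => ?_)
    (fun t => Eventually.of_forall fun y => hC _ (mem_univ _)) (integrable_const _)
    (Eventually.of_forall fun y => ?_)
  · exact (hq.comp (continuous_id.sub continuous_const)).aestronglyMeasurable
  · exact hq.comp (continuous_const.sub (AddCircle.continuous_mk' _))

/-- A superposition of ground states whose profile stays away from `I` up to time `T`. -/
theorem exists_isGrushinEvolution_integral_normSqOn_le {I : Set Torus} {T ε : ℝ}
    (hT : 0 ≤ T) (hε : 0 < ε) (hε4 : ε ≤ 1 / 4) (s : Finset ℕ) (a : ℕ → ℂ)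
    (hpos : 0 < ∫ y : Torus, ‖∑ j ∈ s, a j * fourier j y‖ ^ 2)
    (hI : ∫ t in (0 : ℝ)..T, ∫ y in I, ‖∑ j ∈ s, a j * fourier j (y - (t : Torus))‖ ^ 2 ≤
      ε * ∫ y : Torus, ‖∑ j ∈ s, a j * fourier j y‖ ^ 2) :
    ∃ u : ℝ → L2Cylinder, ‖u 0‖ = 1 ∧ IsGrushinEvolution (u 0) u ∧
      ∫ t in (0 : ℝ)..T, normSqOn (Ioo (-1 : ℝ) 1 ×ˢ I) (u t) ≤ 8 * (1 + T) * ε := by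
  have hex : ∀ n : ℕ, ∃ (f f' : ℝ → ℝ) (μ : ℝ), 1 ≤ n → (∀ x, HasDerivAt f (f' x) x) ∧
      (∀ x, HasDerivAt f' (((n : ℝ) ^ 2 * x ^ 2 - (n + μ)) * f x) x) ∧ f 1 = 0 ∧ f (-1) = 0 ∧
      0 ≤ μ ∧ μ ≤ 12 / n ∧
      ∀ x ∈ Icc (-1 : ℝ) 1, |f x - gaussianProfile n x| ≤ x ^ 2 * gaussianProfile n x := fun n => by
    by_cases hn : 1 ≤ n
    · obtain ⟨f, f', μ, h⟩ := exists_dirichlet_ground_state hn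
      exact ⟨f, f', μ, fun _ => h⟩
    · exact ⟨0, 0, 0, fun h => (hn h).elim⟩
  choose f f' μ hfμ using hex
  obtain ⟨K, hK⟩ := exists_norm_modePacket_sub_le s a (T := T)
    (fun n hn => (hfμ n hn).2.2.2.2.1) (fun n hn => (hfμ n hn).2.2.2.2.2.1)
    (fun n hn => (hfμ n hn).2.2.2.2.2.2)
  set P : Torus → ℂ := fun y => ∑ j ∈ s, a j * fourier j y with hP
  have cP : Continuous P := by fun_prop
  set B := ∫ y, ‖P y‖ ^ 2 with hB
  set V := cylinderMeasure.real univ with hV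
  -- Chosen so that the squared error `(K/N)² V` is at most `ε` times the model mass `E * B`, using
  -- `E ≥ 1/(3N)`.
  obtain ⟨N₀, hN₀⟩ := exists_nat_ge (3 * K ^ 2 * V / (ε * B))
  set N := N₀ + 1 with hN
  have hN1 : 1 ≤ N := by omega
  have hNpos : (0 : ℝ) < N := by exact_mod_cast hN1
  set E := ∫ x in Ioo (-1 : ℝ) 1, gaussianProfile N x ^ 2 with hE
  have hE1 : 1 / (3 * N) ≤ E := inv_le_integral_gaussianProfile_sq hN1
  have hEpos : 0 < E := lt_of_lt_of_le (by positivity) hE1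
  have herr : (K / N) ^ 2 * V ≤ ε * (E * B) := by
    have h1 : 3 * K ^ 2 * V ≤ N * (ε * B) := by
      rw [div_le_iff₀ (by positivity)] at hN₀
      refine hN₀.trans ?_
      gcongr
      rw [hN]; linarith
    calc (K / N) ^ 2 * V = (3 * K ^ 2 * V) / (3 * N ^ 2) := by field_simp
      _ ≤ (N * (ε * B)) / (3 * N ^ 2) := by gcongr
      _ = ε * (1 / (3 * N) * B) := by field_simp
      _ ≤ _ := by gcongr
  set F : ℕ → ℝ × Torus → ℂ := fun j => fourierMode (f (N + j)) (N + j : ℕ) with hF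
  set l : ℕ → ℝ := fun j => (N + j : ℕ) + μ (N + j) with hl
  have cF : ∀ j, Continuous (F j) := fun j => continuous_fourierMode
    (continuous_iff_continuousAt.2 fun x => ((hfμ (N + j) (by omega)).1 x).continuousAt) _
  have hlF : ∀ j φ, IsDirichletTestFunction φ → ∫ p, F j p * grushinLaplacian φ p ∂cylinderMeasure =
      -l j * ∫ p, F j p * φ p ∂cylinderMeasure := fun j φ hφ => by
    obtain ⟨h1, h2, h3, h4, -⟩ := hfμ (N + j) (by omega)
    exact integral_fourierMode_mul_grushinLaplacian hφ h1 h2 h3 h4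
  set W := modePacket s a F l with hW
  have cW : ∀ t, Continuous (W t) := continuous_modePacket s a cF l
  have hclose : ∀ t ∈ Icc 0 T, ∀ p ∈ grushinCylinder, ‖W t p - fourier N (p.2 - (t : Torus)) *
      (gaussianProfile N p.1 * P (p.2 - (t : Torus)))‖ ≤ K / N :=
    fun t ht p hp => hK N hN1 t ht p.1 (Ioo_subset_Icc_self hp.1) p.2
  have hprof : ∀ (t : ℝ) (p : ℝ × Torus), ‖fourier N (p.2 - (t : Torus)) *
      (gaussianProfile N p.1 * P (p.2 - (t : Torus)))‖ ^ 2 =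
      gaussianProfile N p.1 ^ 2 * ‖P (p.2 - (t : Torus))‖ ^ 2 := fun t p => by
    rw [norm_mul, norm_mul, fourier_apply, Circle.norm_coe, one_mul, Complex.norm_real, mul_pow,
      Real.norm_eq_abs, sq_abs]
  have cg : Continuous (gaussianProfile N) := by unfold gaussianProfile; fun_prop
  have cprof : ∀ t : ℝ, Continuous fun p : ℝ × Torus =>
      gaussianProfile N p.1 ^ 2 * ‖P (p.2 - (t : Torus))‖ ^ 2 := fun t => by fun_prop
  have iprof := fun t => integrable_of_continuous_real (cprof t)
  have iW : ∀ t, Integrable (fun p => ‖W t p‖ ^ 2) cylinderMeasure := fun t =>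
    integrable_of_continuous_real ((cW t).norm.pow 2)
  set D := ∫ p, ‖W 0 p‖ ^ 2 ∂cylinderMeasure with hD
  -- `E * B ≤ 2D + 2ε(E * B)`, and `ε ≤ 1/4` absorbs the last term into the left side.
  have hDlow : E * B ≤ 4 * D := by
    have h1 : E * B ≤ 2 * D + 2 * (K / N) ^ 2 * V := by
      rw [hE, hB, ← integral_cylinder_mul]
      have h2 : ∫ p, gaussianProfile N p.1 ^ 2 * ‖P p.2‖ ^ 2 ∂cylinderMeasure ≤
          ∫ p, (2 * ‖W 0 p‖ ^ 2 + 2 * (K / N) ^ 2) ∂cylinderMeasure := by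
        refine integral_mono_ae (by simpa using iprof 0)
          (((iW 0).const_mul 2).add (integrable_const _)) ?_
        filter_upwards [ae_mem_grushinCylinder] with p hp
        have h3 := hclose 0 ⟨le_rfl, hT⟩ p hp
        rw [norm_sub_rev] at h3
        have h4 := norm_sq_le_two_mul_add h3
        rw [hprof] at h4
        simpa using h4
      refine h2.trans_eq ?_
      rw [integral_add ((iW 0).const_mul 2) (integrable_const _), integral_const_mul, integral_const,
        smul_eq_mul]
      ring
    nlinarith [mul_pos hEpos hpos]
  have hDpos : 0 < D := by nlinarith [mul_pos hEpos hpos]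
  obtain ⟨u, hu, hae⟩ := exists_isGrushinEvolution_modePacket s
    (fun j => (((√D)⁻¹ : ℝ) : ℂ) * a j) cF hlF
  have hc : ∀ t p, ‖modePacket s (fun j => (((√D)⁻¹ : ℝ) : ℂ) * a j) F l t p‖ ^ 2 =
      D⁻¹ * ‖W t p‖ ^ 2 := fun t p => by
    rw [modePacket_const_mul, norm_mul, mul_pow, Complex.norm_real, Real.norm_eq_abs, sq_abs,
      inv_pow, sq_sqrt hDpos.le]
  refine ⟨u, ?_, hu, ?_⟩
  · have h1 := norm_sq_eq_integral_of_ae_eq (hae 0)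
    simp only [hc] at h1
    rw [integral_const_mul, ← hD, inv_mul_cancel₀ hDpos.ne'] at h1
    exact (pow_eq_one_iff_of_nonneg (norm_nonneg _) two_ne_zero).1 h1
  set A : ℝ → ℝ := fun t => ∫ y in I, ‖P (y - (t : Torus))‖ ^ 2 with hA
  have cA : Continuous A := continuous_setIntegral_sub (q := fun y => ‖P y‖ ^ 2) (by fun_prop)
  have hbound : ∀ t ∈ Icc 0 T, normSqOn (Ioo (-1 : ℝ) 1 ×ˢ I) (u t) ≤
      D⁻¹ * (2 * (E * A t) + 2 * ((K / N) ^ 2 * V)) := fun t ht => by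
    rw [normSqOn_of_ae_eq (hae t)]
    simp only [hc]
    rw [integral_const_mul]
    refine mul_le_mul_of_nonneg_left ?_ (by positivity)
    rw [hE, hA, ← setIntegral_cylinder_mul I (fun x => gaussianProfile N x ^ 2)
      (fun y => ‖P (y - (t : Torus))‖ ^ 2)]
    have h2 : ∫ p in Ioo (-1 : ℝ) 1 ×ˢ I, ‖W t p‖ ^ 2 ∂cylinderMeasure ≤
        ∫ p in Ioo (-1 : ℝ) 1 ×ˢ I, (2 * (gaussianProfile N p.1 ^ 2 * ‖P (p.2 - (t : Torus))‖ ^ 2) +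
          2 * (K / N) ^ 2) ∂cylinderMeasure := by
      refine integral_mono_ae (iW t).integrableOn
        (((iprof t).integrableOn.const_mul 2).add (integrable_const _)) ?_
      filter_upwards [ae_restrict_of_ae ae_mem_grushinCylinder] with p hp
      have h4 := norm_sq_le_two_mul_add (hclose t ht p hp)
      rwa [hprof] at h4
    refine h2.trans ?_
    rw [integral_add ((iprof t).integrableOn.const_mul 2) (integrable_const _), integral_const_mul,
      integral_const, smul_eq_mul]
    have h5 : (cylinderMeasure.restrict (Ioo (-1 : ℝ) 1 ×ˢ I)).real univ ≤ V :=
      ENNReal.toReal_mono (measure_ne_top _ _) (Measure.restrict_apply_le _ _)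
    nlinarith [mul_le_mul_of_nonneg_left h5 (sq_nonneg (K / N))]
  have hint : ∫ t in (0 : ℝ)..T, normSqOn (Ioo (-1 : ℝ) 1 ×ˢ I) (u t) ≤
      ∫ t in (0 : ℝ)..T, D⁻¹ * (2 * (E * A t) + 2 * ((K / N) ^ 2 * V)) := by
    rw [intervalIntegral.integral_of_le hT, intervalIntegral.integral_of_le hT]
    refine integral_mono_of_nonneg
      (Eventually.of_forall fun t => integral_nonneg fun p => by positivity)
      ((show Continuous fun t => D⁻¹ * (2 * (E * A t) + 2 * ((K / N) ^ 2 * V)) by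
        fun_prop).integrableOn_Ioc) ?_
    filter_upwards [ae_restrict_mem measurableSet_Ioc] with t ht
    exact hbound t (Ioc_subset_Icc_self ht)
  -- Transport contributes `2ε(E * B)` and the error `2Tε(E * B)`; dividing by `D ≥ E * B / 4` gives
  -- `8(1 + T)ε`.
  refine hint.trans ?_
  rw [intervalIntegral.integral_const_mul, intervalIntegral.integral_add
    ((show Continuous fun t => 2 * (E * A t) by fun_prop).intervalIntegrable _ _)
    intervalIntegrable_const, intervalIntegral.integral_const_mul,
    intervalIntegral.integral_const_mul, intervalIntegral.integral_const, sub_zero, smul_eq_mul,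
    inv_mul_le_iff₀ hDpos]
  have hI' : ∫ t in (0 : ℝ)..T, A t ≤ ε * B := hI
  have h6 := mul_le_mul_of_nonneg_left hI' hEpos.le
  have h7 := mul_le_mul_of_nonneg_left herr hT
  have h8 := mul_le_mul_of_nonneg_left hDlow (by positivity : 0 ≤ ε * (1 + T))
  nlinarith

theorem theorem3 (ω : Set (ℝ × Torus)) (hω : IsHorizontalStrips ω)
    (T₀ : ℝ) (hT₀ : 0 < T₀) (hT₀ω : T₀ ≤ gapLength ω) :
    ∃ (u₀ : ℕ → L2Cylinder) (u : ℕ → ℝ → L2Cylinder),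
      (∀ k, ‖u₀ k‖ = 1) ∧
      (∀ k, IsGrushinEvolution (u₀ k) (u k)) ∧
      Tendsto (fun k => ∫ t in (0 : ℝ)..T₀, normSqOn ω (u k t)) atTop (𝓝 0) := by
  obtain ⟨I, hI, rfl⟩ := hω.exists_measurableSet
  have h : ∀ k : ℕ, ∃ u : ℝ → L2Cylinder, ‖u 0‖ = 1 ∧ IsGrushinEvolution (u 0) u ∧
      ∫ t in (0 : ℝ)..T₀, normSqOn (Ioo (-1 : ℝ) 1 ×ˢ I) (u t) ≤
        -- The shift by `4` keeps `ε = 1/(k + 4)` at most `1/4`, as the mass comparison requires.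
        8 * (1 + T₀) * (1 / ((k : ℝ) + 4)) := fun k => by
    have hk : (0 : ℝ) < 1 / ((k : ℝ) + 4) := by positivity
    obtain ⟨s, y, hs, hsT, hsε, havoid⟩ := exists_arc_of_le_gapLength hT₀ hT₀ω hk
    obtain ⟨m, hm⟩ := exists_trigPeak_transport_le hI hs hsT havoid hsε
    refine exists_isGrushinEvolution_integral_normSqOn_le hT₀.le hk ?_ (Finset.range (m + 1)) _
      (integral_norm_sq_trigPeak_pos y m) hm
    exact one_div_le_one_div_of_le (by norm_num) (by linarith [(Nat.cast_nonneg k : (0 : ℝ) ≤ k)])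
  choose u hu1 hu2 hu3 using h
  refine ⟨fun k => u k 0, u, hu1, hu2, ?_⟩
  refine squeeze_zero (fun k => intervalIntegral.integral_nonneg hT₀.le fun t _ =>
    integral_nonneg fun p => by positivity) hu3 ?_
  have h4 : Tendsto (fun k : ℕ => 1 / ((k : ℝ) + 4)) atTop (𝓝 0) := by
    have := tendsto_const_nhds (x := (1 : ℝ)).div_atTop
      (tendsto_atTop_add_const_right atTop (4 : ℝ) tendsto_natCast_atTop_atTop)
    exact this
  simpa using h4.const_mul (8 * (1 + T₀))
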